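/- Let $\rho>1$ and $\lambda>0$. For real random variables $X_1,X_2,\dots$ let $B_{n,j}$ be the number of $i\le n$ with $\rho^{j-1}<X_i\le\rho^{j}$ ($j\in\mathbb Z$), and let $K_n=\#\{j\in\mathbb Z: B_{n,j}>0\}$ be the number of occupied bins. Put $u=\rho^{-\rho/(\rho-1)}$ and $c=\frac{\rho\log\rho}{\lambda(\rho-1)}$, and define the distribution functions $$F_0(x)=\begin{cases}0,&x\le 0\\ \frac{1-e^{-\lambda x}}{1-u},&0<x<c\\ 1,&x\ge c\end{cases}\qquad F_1(x)=\begin{cases}0,&x\le c\\ 1-e^{-\lambda(x-c)},&x>c.\end{cases}$$ Write $\mathbb E_0,\mathbb E_1,\mathbb E$ for expectation when the $X_i$ are i.i.d. with distribution function $F_0$, with distribution function $F_1$, and with law $\mathrm{Exp}(\lambda)$ of rate $\lambda$, respectively. Let $W_0$ and $W_{-1}$ be the two real branches of the Lambert function: $w=W_0(x)$, $x\ge -1/e$, is the solution $w\ge-1$ of $we^w=x$, and $w=W_{-1}(x)$, $-1/e\le x<0$, is the solution $w\le -1$. Here $a_n\sim b_n$ means $a_n/b_n\to1$ as $n\to\infty$.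 (1) As $n\to\infty$, $$\mathbb E_0K_n\sim\log_\rho\!\Big(\frac{n\log\rho}{1-u}\Big)+\frac1{\log\rho}W_0\!\Big(-\frac{(1-u)\sqrt\rho}{(\rho-1)n}\Big)\sim\log_\rho n .$$ (2) Let $\eta_{\rho,n}=\log(n\log\rho)+\frac{\rho\log\rho}{\rho-1}$. As $n\to\infty$, $$\mathbb E_1K_n\sim\log_\rho\!\Big(-\frac{\rho-1}{\log\rho}W_{-1}\!\Big(-\frac{u}{n\log\rho}\Big)\Big)\le\log_\rho\!\Big(\frac{\rho-1}{\log\rho}\Big(\eta_{\rho,n}+\sqrt{2(\eta_{\rho,n}-1)}\Big)\Big)\sim\log_\rho\log_\rho n ,$$ where the argument of $W_{-1}$ lies in $[-1/e,0)$ for all large $n$, and the inequality holds for every $n\ge 1$ for which it does. (3) Let $n_0=n(1-u)$ and $n_1=nu$; these are the expected numbers of $i\le n$ with $X_i\le c$ and with $X_i>c$ under $\mathrm{Exp}(\lambda)$, and $c=\rho^{\kappa}$ for $\kappa=1+\log_\rho\frac{\log\rho}{\lambda(\rho-1)}$. Whenever $a_n,b_n$ are integers obtained by rounding $n_0,n_1$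 up or down, $$\mathbb EK_n\sim\mathbb E_0K_{a_n}+\mathbb E_1K_{b_n},\qquad \sup_n\big|\mathbb EK_n-(\mathbb E_0K_{a_n}+\mathbb E_1K_{b_n})\big|<\infty .$$ Moreover $\mathbb EK_n\lesssim\log_\rho n$, that is, $\limsup_{n\to\infty}\mathbb EK_n/\log_\rho n\le1$. -/

import Mathlib

open MeasureTheory ProbabilityTheory Filter Asymptotics
open scoped Topology

noncomputable section

namespace ExpHist

/-- The Lambert `W₀` function (principal branch): for `x ≥ -1/e`, the unique `w ≥ -1` with
`w * exp w = x`. -/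
def lambertW0 (x : ℝ) : ℝ :=
  Function.invFunOn (fun w : ℝ => w * Real.exp w) (Set.Ici (-1)) x

/-- The Lambert `W₋₁` function: for `-1/e ≤ x < 0`, the unique `w ≤ -1` with `w * exp w = x`. -/
def lambertWm1 (x : ℝ) : ℝ :=
  Function.invFunOn (fun w : ℝ => w * Real.exp w) (Set.Iic (-1)) x

/-- `X 0, X 1, …` are independent real random variables on `(Ω, P)` with common distribution
function `F`. -/
structure IsIIDSample {Ω : Type*} [MeasurableSpace Ω] (P : Measure Ω) (X : ℕ → Ω → ℝ)
    (F : ℝ → ℝ) : Prop where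
  aemeasurable : ∀ i, AEMeasurable (X i) P
  indep : iIndepFun X P
  cdf_eq : ∀ i x, P.real {ω | X i ω ≤ x} = F x

open Classical in
/-- The bin count `B_{n,j}`: how many of the first `n` values lie in `(ρ^(j-1), ρ^j]`. -/
def binCount {Ω : Type*} (ρ : ℝ) (X : ℕ → Ω → ℝ) (n : ℕ) (j : ℤ) (ω : Ω) : ℕ :=
  ((Finset.range n).filter (fun i => ρ ^ (j - 1) < X i ω ∧ X i ω ≤ ρ ^ j)).card

/-- The occupancy `K_n`: the number of bins `j ∈ ℤ` with `B_{n,j} > 0` (at most `n` of them, the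
bins being disjoint when `ρ > 1`). -/
def occupancy {Ω : Type*} (ρ : ℝ) (X : ℕ → Ω → ℝ) (n : ℕ) (ω : Ω) : ℕ :=
  {j : ℤ | 0 < binCount ρ X n j ω}.ncard

/-- The expected occupancy `𝔼 K_n`. -/
def expectedOccupancy {Ω : Type*} [MeasurableSpace Ω] (P : Measure Ω) (ρ : ℝ) (X : ℕ → Ω → ℝ)
    (n : ℕ) : ℝ :=
  ∫ ω, (occupancy ρ X n ω : ℝ) ∂P

/-- `κ_{lam,ρ} = 1 + log_ρ (log ρ / (lam (ρ - 1)))`. -/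
def kappa (lam ρ : ℝ) : ℝ :=
  1 + Real.logb ρ (Real.log ρ / (lam * (ρ - 1)))

/-- The cutoff `ρ log ρ / (lam (ρ - 1))` at which the exponential distribution is split. -/
def cutoff (lam ρ : ℝ) : ℝ :=
  ρ * Real.log ρ / (lam * (ρ - 1))

/-- `ρ^(-ρ/(ρ-1))`, the mass of the exponential distribution above the cutoff. -/
def upperMass (ρ : ℝ) : ℝ :=
  ρ ^ (-(ρ / (ρ - 1)))

open Classical in
/-- The distribution function `F₀` of the lower part of `Exp(lam)`. -/
def F0 (lam ρ : ℝ) (x : ℝ) : ℝ :=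
  if x ≤ 0 then 0
  else if x < cutoff lam ρ then (1 - Real.exp (-(lam * x))) / (1 - upperMass ρ)
  else 1

open Classical in
/-- The distribution function `F₁` of the upper part of `Exp(lam)`. -/
def F1 (lam ρ : ℝ) (x : ℝ) : ℝ :=
  if x ≤ cutoff lam ρ then 0
  else 1 - Real.exp (-(lam * (x - cutoff lam ρ)))

/-- `η_{ρ,n} = log (n log ρ) + ρ log ρ / (ρ - 1)`. -/
def eta (ρ : ℝ) (n : ℕ) : ℝ :=
  Real.log (n * Real.log ρ) + ρ * Real.log ρ / (ρ - 1)

/-- The approximation of `𝔼 K_n` under `F₀`. -/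
def approx0 (ρ : ℝ) (n : ℕ) : ℝ :=
  Real.logb ρ (n * Real.log ρ / (1 - upperMass ρ)) +
    1 / Real.log ρ * lambertW0 (-((1 - upperMass ρ) * √ρ / ((ρ - 1) * n)))

/-- The argument of `W₋₁` in the approximation of `𝔼 K_n` under `F₁`. -/
def arg1 (ρ : ℝ) (n : ℕ) : ℝ :=
  -(upperMass ρ / (n * Real.log ρ))

/-- The approximation of `𝔼 K_n` under `F₁`. -/
def approx1 (ρ : ℝ) (n : ℕ) : ℝ :=
  Real.logb ρ (-((ρ - 1) / Real.log ρ * lambertWm1 (arg1 ρ n)))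

/-- The explicit upper bound on the approximation of `𝔼 K_n` under `F₁`. -/
def bound1 (ρ : ℝ) (n : ℕ) : ℝ :=
  Real.logb ρ ((ρ - 1) / Real.log ρ * (eta ρ n + √(2 * (eta ρ n - 1))))

end ExpHist

end

/-! Every asymptotic claim follows from a bounded-error estimate: the expected occupancy is `log_ρ n
+ O(1)` under `F0`, `log_ρ log n + O(1)` under `F1`, and the sum of the two plus `O(1)` under
`Exp(lam)`. The bins that matter run from scale `1/n`, below which `O(1)` samples are expected, up
to scale `log n`, beyond which the same holds; the cutoff splits this range at a fixed scale.

Upper bound (`expectedOccupancy_le_add`): each occupied bin outside a window `[L, U]` contains a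
sample outside the window, so the occupancy is at most the window length plus the number of outlying
samples.

Lower bound (`card_sub_sum_le_expectedOccupancy`, `sub_le_expectedOccupancy`): a bin of mass `p` is
empty with probability at most `1/(n p)`. Far below the top scale `p` is of order `ρ^j`; higher up,
as long as `lam * ρ^(j-1) ≤ (log n)/2`, the expected count `n p` is at least a multiple of `ρ^j`. In
both ranges the reciprocals are dominated by a geometric series whose sum is `O(1)`.

The Lambert expressions need only the same precision. The `W₀` argument tends to `0`, so that term
is bounded; `w = -W₋₁` solves `w - log w = η`, which places `w` between `η` and `2η`, and `η` is
comparable to `log n`. Bounded differences between functions tending to infinity give equivalence.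
Rounding `n(1-u)` and `nu` changes the logarithms by `O(1)`. -/

namespace ExpHist

/-! ### Bounds on the occupancy of an i.i.d. sample with arbitrary distribution function -/

section Occupancy

variable {Ω : Type*} [MeasurableSpace Ω] {P : Measure Ω} {X : ℕ → Ω → ℝ} {F : ℝ → ℝ} {ρ : ℝ}

lemma binCount_pos_iff {Ω : Type*} (ρ : ℝ) (X : ℕ → Ω → ℝ) (n : ℕ) (j : ℤ) (ω : Ω) :
    0 < binCount ρ X n j ω ↔ ∃ i < n, X i ω ∈ Set.Ioc (ρ ^ (j - 1)) (ρ ^ j) := by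
  simp [binCount, Finset.card_pos, Finset.filter_nonempty_iff]

lemma bin_index_unique (hρ : 1 < ρ) {x : ℝ} {j : ℤ} (hx : x ∈ Set.Ioc (ρ ^ (j - 1)) (ρ ^ j)) :
    ⌈Real.logb ρ x⌉ = j := by
  have hρ0 : 0 < ρ := by linarith
  have hx0 : 0 < x := (zpow_pos hρ0 _).trans hx.1
  rw [Int.ceil_eq_iff]
  constructor
  · rw [Real.lt_logb_iff_rpow_lt hρ hx0]
    have := hx.1
    rw [← Real.rpow_intCast] at this
    push_cast at this
    exact this
  · rw [Real.logb_le_iff_le_rpow hρ hx0, Real.rpow_intCast]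
    exact hx.2

lemma occupied_subset (hρ : 1 < ρ) {Ω : Type*} (X : ℕ → Ω → ℝ) (n : ℕ) (ω : Ω) :
    {j : ℤ | 0 < binCount ρ X n j ω} ⊆
      ((Finset.range n).image (fun i => ⌈Real.logb ρ (X i ω)⌉) : Finset ℤ) := by
  intro j hj
  obtain ⟨i, hi, hx⟩ := (binCount_pos_iff ρ X n j ω).1 hj
  simp only [Finset.coe_image, Finset.coe_range, Set.mem_image, Set.mem_Iio]
  exact ⟨i, hi, bin_index_unique hρ hx⟩

lemma occupied_finite (hρ : 1 < ρ) {Ω : Type*} (X : ℕ → Ω → ℝ) (n : ℕ) (ω : Ω) :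
    {j : ℤ | 0 < binCount ρ X n j ω}.Finite :=
  (Finset.finite_toSet _).subset (occupied_subset hρ X n ω)

lemma occupancy_le (hρ : 1 < ρ) {Ω : Type*} (X : ℕ → Ω → ℝ) (n : ℕ) (ω : Ω) :
    occupancy ρ X n ω ≤ n := by
  have h := Set.ncard_le_ncard (occupied_subset hρ X n ω) (Finset.finite_toSet _)
  rw [Set.ncard_coe_finset] at h
  exact h.trans (Finset.card_image_le.trans (by simp))

-- An occupied bin with index outside `[L, U]` is charged to a sample lying in it. A sample
-- determines its bin, so the number of such bins is at most the number of samples outside the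
-- window.
open Classical in
lemma occupancy_le_add (hρ : 1 < ρ) {Ω : Type*} (X : ℕ → Ω → ℝ) (n : ℕ) (ω : Ω) (L U : ℤ) :
    occupancy ρ X n ω ≤ (U + 1 - L).toNat +
      (((Finset.range n).filter (fun i => X i ω ≤ ρ ^ (L - 1))).card +
        ((Finset.range n).filter (fun i => ρ ^ U < X i ω)).card) := by
  set A := (Finset.range n).filter (fun i => X i ω ≤ ρ ^ (L - 1))
  set B := (Finset.range n).filter (fun i => ρ ^ U < X i ω)
  have hsub : {j : ℤ | 0 < binCount ρ X n j ω} ⊆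
      (Finset.Icc L U ∪ (A ∪ B).image (fun i => ⌈Real.logb ρ (X i ω)⌉) : Finset ℤ) := by
    intro j hj
    obtain ⟨i, hi, hx⟩ := (binCount_pos_iff ρ X n j ω).1 hj
    rw [Finset.mem_coe, Finset.mem_union, Finset.mem_image]
    by_cases h1 : X i ω ≤ ρ ^ (L - 1)
    · exact Or.inr ⟨i, by simp [A, hi, h1], bin_index_unique hρ hx⟩
    by_cases h2 : ρ ^ U < X i ω
    · exact Or.inr ⟨i, by simp [B, hi, h2], bin_index_unique hρ hx⟩
    push Not at h1 h2
    have h3 : L - 1 < j := (zpow_lt_zpow_iff_right₀ hρ).1 (h1.trans_le hx.2)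
    have h4 : j - 1 < U := (zpow_lt_zpow_iff_right₀ hρ).1 (hx.1.trans_le h2)
    exact Or.inl (Finset.mem_Icc.2 ⟨by omega, by omega⟩)
  have h := Set.ncard_le_ncard hsub (Finset.finite_toSet _)
  rw [Set.ncard_coe_finset] at h
  refine h.trans ((Finset.card_union_le _ _).trans ?_)
  rw [Int.card_Icc]
  exact Nat.add_le_add_left (Finset.card_image_le.trans (Finset.card_union_le _ _)) _

open Classical in
lemma card_filter_le_occupancy (hρ : 1 < ρ) {Ω : Type*} (X : ℕ → Ω → ℝ) (n : ℕ) (ω : Ω)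
    (S : Finset ℤ) :
    (S.filter (fun j => 0 < binCount ρ X n j ω)).card ≤ occupancy ρ X n ω := by
  rw [← Set.ncard_coe_finset]
  exact Set.ncard_le_ncard (fun j hj => (Finset.mem_filter.1 hj).2) (occupied_finite hρ X n ω)

open Classical in
lemma card_filter_eq_sum_indicator {ι : Type*} {Ω : Type*} (S : Finset ι) (A : ι → Set Ω) (ω : Ω) :
    ((S.filter (fun i => ω ∈ A i)).card : ℝ) = ∑ i ∈ S, (A i).indicator (fun _ => (1 : ℝ)) ω := by
  simp [Set.indicator_apply]

lemma integrable_indicator_one [IsFiniteMeasure P] {A : Set Ω} (hA : NullMeasurableSet A P) :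
    Integrable (A.indicator (fun _ => (1 : ℝ))) P :=
  (integrable_const 1).indicator₀ hA

open Classical in
lemma integrable_card_filter [IsFiniteMeasure P] {ι : Type*} (S : Finset ι) {A : ι → Set Ω}
    (hA : ∀ i ∈ S, NullMeasurableSet (A i) P) :
    Integrable (fun ω => ((S.filter (fun i => ω ∈ A i)).card : ℝ)) P := by
  simp_rw [card_filter_eq_sum_indicator]
  exact integrable_finsetSum _ fun i hi => integrable_indicator_one (hA i hi)

open Classical in
lemma integral_card_filter [IsFiniteMeasure P] {ι : Type*} (S : Finset ι) {A : ι → Set Ω}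
    (hA : ∀ i ∈ S, NullMeasurableSet (A i) P) :
    ∫ ω, ((S.filter (fun i => ω ∈ A i)).card : ℝ) ∂P = ∑ i ∈ S, P.real (A i) := by
  simp_rw [card_filter_eq_sum_indicator]
  rw [integral_finsetSum _ fun i hi => integrable_indicator_one (hA i hi)]
  refine Finset.sum_congr rfl fun i hi => ?_
  rw [integral_indicator₀ (hA i hi)]
  simp

namespace IsIIDSample

lemma nullMeasurableSet (hX : IsIIDSample P X F) (i : ℕ) {s : Set ℝ} (hs : MeasurableSet s) :
    NullMeasurableSet (X i ⁻¹' s) P :=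
  (hX.aemeasurable i).nullMeasurableSet_preimage hs

lemma nullMeasurableSet_occupied (hX : IsIIDSample P X F) (n : ℕ) (j : ℤ) :
    NullMeasurableSet {ω | 0 < binCount ρ X n j ω} P := by
  have : {ω | 0 < binCount ρ X n j ω} =
      ⋃ i ∈ Finset.range n, X i ⁻¹' Set.Ioc (ρ ^ (j - 1)) (ρ ^ j) := by
    ext ω
    simp only [Set.mem_ofPred_eq, binCount_pos_iff, Set.mem_iUnion, Finset.mem_range,
      Set.mem_preimage, exists_prop]
  rw [this]
  exact NullMeasurableSet.biUnion (Finset.countable_toSet _)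
    fun i _ => hX.nullMeasurableSet i measurableSet_Ioc

/-- The occupancy is a countable sum of indicators of occupied-bin events. Summing in `ENNReal`
avoids convergence questions, and finiteness of the occupied set identifies the sum with `ncard`. -/
lemma aemeasurable_occupancy (hX : IsIIDSample P X F) (hρ : 1 < ρ) (n : ℕ) :
    AEMeasurable (fun ω => (occupancy ρ X n ω : ℝ)) P := by
  have h : (fun ω => (occupancy ρ X n ω : ℝ)) = fun ω =>
      (∑' j : ℤ, {ω | 0 < binCount ρ X n j ω}.indicator (fun _ => (1 : ENNReal)) ω).toReal := by
    funext ω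
    have h1 : ∑' j : ℤ, {ω | 0 < binCount ρ X n j ω}.indicator (fun _ => (1 : ENNReal)) ω =
        ∑' j : {j : ℤ | 0 < binCount ρ X n j ω}, (1 : ENNReal) := by
      rw [tsum_subtype {j : ℤ | 0 < binCount ρ X n j ω} (fun _ => (1 : ENNReal))]
      rfl
    rw [h1, ENNReal.tsum_set_one, ← (occupied_finite hρ X n ω).cast_ncard_eq]
    simp [occupancy]
  rw [h]
  exact (AEMeasurable.tsum fun j =>
    aemeasurable_const.indicator₀ (hX.nullMeasurableSet_occupied n j)).ennreal_toReal

variable [IsProbabilityMeasure P]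

lemma integrable_occupancy (hX : IsIIDSample P X F) (hρ : 1 < ρ) (n : ℕ) :
    Integrable (fun ω => (occupancy ρ X n ω : ℝ)) P := by
  refine Integrable.of_bound (hX.aemeasurable_occupancy hρ n).aestronglyMeasurable n ?_
  refine Eventually.of_forall fun ω => ?_
  rw [Real.norm_of_nonneg (Nat.cast_nonneg _)]
  exact_mod_cast occupancy_le hρ X n ω

lemma measureReal_lt (hX : IsIIDSample P X F) (i : ℕ) (x : ℝ) :
    P.real {ω | x < X i ω} = 1 - F x := by
  have h := probReal_compl_eq_one_sub₀ (μ := P) (hX.nullMeasurableSet i (measurableSet_Iic (a := x)))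
  have h2 : P.real (X i ⁻¹' Set.Iic x) = F x := hX.cdf_eq i x
  rw [h2] at h
  rw [← h]
  congr 1
  ext ω
  simp

open Classical in
lemma integral_card_le (hX : IsIIDSample P X F) (n : ℕ) (x : ℝ) :
    ∫ ω, (((Finset.range n).filter (fun i => X i ω ≤ x)).card : ℝ) ∂P = n * F x := by
  have h := integral_card_filter (P := P) (Finset.range n) (A := fun i => {ω | X i ω ≤ x})
    (fun i _ => hX.nullMeasurableSet i measurableSet_Iic)
  simpa [hX.cdf_eq] using h

open Classical in
lemma integral_card_lt (hX : IsIIDSample P X F) (n : ℕ) (x : ℝ) :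
    ∫ ω, (((Finset.range n).filter (fun i => x < X i ω)).card : ℝ) ∂P = n * (1 - F x) := by
  have h := integral_card_filter (P := P) (Finset.range n) (A := fun i => {ω | x < X i ω})
    (fun i _ => hX.nullMeasurableSet i measurableSet_Ioi)
  simpa only [hX.measureReal_lt, Set.mem_ofPred_eq, Finset.sum_const, Finset.card_range, nsmul_eq_mul] using h

open Classical in
lemma expectedOccupancy_le_add (hX : IsIIDSample P X F) (hρ : 1 < ρ) (n : ℕ) {L U : ℤ}
    (hLU : L ≤ U + 1) :
    expectedOccupancy P ρ X n ≤ (U + 1 - L : ℝ) + (n * F (ρ ^ (L - 1)) + n * (1 - F (ρ ^ U))) := by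
  have i1 : Integrable (fun ω => (((Finset.range n).filter
      (fun i => X i ω ≤ ρ ^ (L - 1))).card : ℝ)) P :=
    integrable_card_filter (P := P) (Finset.range n) (A := fun i => {ω | X i ω ≤ ρ ^ (L - 1)})
      (fun i _ => hX.nullMeasurableSet i measurableSet_Iic)
  have i2 : Integrable (fun ω => (((Finset.range n).filter
      (fun i => ρ ^ U < X i ω)).card : ℝ)) P :=
    integrable_card_filter (P := P) (Finset.range n) (A := fun i => {ω | ρ ^ U < X i ω})
      (fun i _ => hX.nullMeasurableSet i measurableSet_Ioi)
  have key : ∀ ω, (occupancy ρ X n ω : ℝ) ≤ (U + 1 - L : ℝ) +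
      ((((Finset.range n).filter (fun i => X i ω ≤ ρ ^ (L - 1))).card : ℝ) +
        (((Finset.range n).filter (fun i => ρ ^ U < X i ω)).card : ℝ)) := by
    intro ω
    have h := occupancy_le_add hρ X n ω L U
    have h2 : ((U + 1 - L).toNat : ℝ) = (U + 1 - L : ℝ) := by
      have : (((U + 1 - L).toNat : ℤ) : ℝ) = ((U + 1 - L : ℤ) : ℝ) := by
        rw [Int.toNat_of_nonneg (by omega)]
      push_cast at this
      exact this
    rw [← h2]
    exact_mod_cast h
  calc expectedOccupancy P ρ X n ≤ ∫ ω, ((U + 1 - L : ℝ) +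
      ((((Finset.range n).filter (fun i => X i ω ≤ ρ ^ (L - 1))).card : ℝ) +
        (((Finset.range n).filter (fun i => ρ ^ U < X i ω)).card : ℝ))) ∂P :=
        integral_mono (hX.integrable_occupancy hρ n)
          ((integrable_const _).add (i1.add i2)) key
    _ = _ := by
      rw [integral_add (integrable_const _) (by exact i1.add i2), integral_add i1 i2,
        hX.integral_card_le, hX.integral_card_lt]
      simp

lemma measureReal_bin (hX : IsIIDSample P X F) (i : ℕ) {x y : ℝ} (hxy : x ≤ y) :
    P.real (X i ⁻¹' Set.Ioc x y) = F y - F x := by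
  rw [← hX.cdf_eq i y, ← hX.cdf_eq i x]
  have h : X i ⁻¹' Set.Ioc x y = {ω | X i ω ≤ y} \ {ω | X i ω ≤ x} := by
    ext ω
    simp [and_comm]
  rw [h]
  have hsub : {ω | X i ω ≤ x} ⊆ {ω | X i ω ≤ y} := fun ω (hω : X i ω ≤ x) => hω.trans hxy
  rw [Measure.real, measure_sdiff hsub (hX.nullMeasurableSet i measurableSet_Iic)
    (measure_ne_top _ _), ENNReal.toReal_sub_of_le (measure_mono hsub) (measure_ne_top _ _)]
  rfl

lemma measureReal_bin_empty (hX : IsIIDSample P X F) (n : ℕ) {x y : ℝ} (hxy : x ≤ y) :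
    P.real (⋂ i ∈ Finset.range n, X i ⁻¹' (Set.Ioc x y)ᶜ) = (1 - (F y - F x)) ^ n := by
  have h := hX.indep.measure_inter_preimage_eq_mul (Finset.range n)
    (sets := fun _ => (Set.Ioc x y)ᶜ) (fun i _ => measurableSet_Ioc.compl)
  rw [Measure.real, h, ENNReal.toReal_prod]
  rw [Finset.prod_congr rfl (g := fun _ => 1 - (F y - F x)), Finset.prod_const, Finset.card_range]
  intro i _
  rw [← hX.measureReal_bin i hxy]
  exact probReal_compl_eq_one_sub₀ (hX.nullMeasurableSet i measurableSet_Ioc)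

lemma measureReal_occupied (hX : IsIIDSample P X F) (hρ : 1 < ρ) (n : ℕ) (j : ℤ) :
    P.real {ω | 0 < binCount ρ X n j ω} = 1 - (1 - (F (ρ ^ j) - F (ρ ^ (j - 1)))) ^ n := by
  have hle : ρ ^ (j - 1) ≤ ρ ^ j := zpow_le_zpow_right₀ hρ.le (by omega)
  rw [← hX.measureReal_bin_empty n hle]
  have h := probReal_compl_eq_one_sub₀ (μ := P) (hX.nullMeasurableSet_occupied (ρ := ρ) n j)
  have h2 : {ω | 0 < binCount ρ X n j ω}ᶜ =
      ⋂ i ∈ Finset.range n, X i ⁻¹' (Set.Ioc (ρ ^ (j - 1)) (ρ ^ j))ᶜ := by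
    ext ω
    rw [Set.mem_compl_iff, Set.mem_ofPred_eq, binCount_pos_iff]
    simp only [Set.mem_iInter, Finset.mem_range, Set.mem_preimage, Set.mem_compl_iff, not_exists,
      not_and]
  rw [← h2, h]
  ring

open Classical in
lemma sum_le_expectedOccupancy (hX : IsIIDSample P X F) (hρ : 1 < ρ) (n : ℕ) (S : Finset ℤ) :
    ∑ j ∈ S, (1 - (1 - (F (ρ ^ j) - F (ρ ^ (j - 1)))) ^ n) ≤ expectedOccupancy P ρ X n := by
  have hA : ∀ j ∈ S, NullMeasurableSet {ω | 0 < binCount ρ X n j ω} P :=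
    fun j _ => hX.nullMeasurableSet_occupied n j
  rw [Finset.sum_congr rfl fun j _ => (hX.measureReal_occupied hρ n j).symm,
    ← integral_card_filter S hA]
  refine integral_mono (integrable_card_filter S hA) (hX.integrable_occupancy hρ n) fun ω => ?_
  have h := card_filter_le_occupancy hρ X n ω S
  simpa only [Set.mem_ofPred_eq] using Nat.cast_le (α := ℝ).2 h

/-- The expected occupancy is at least the number of bins in `S`, up to the sum of the inverse
expected bin counts. -/
lemma card_sub_sum_le_expectedOccupancy (hX : IsIIDSample P X F) (hρ : 1 < ρ) (n : ℕ)
    (S : Finset ℤ) {q : ℤ → ℝ} (hq : ∀ j ∈ S, 0 < q j)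
    (hqF : ∀ j ∈ S, q j ≤ n * (F (ρ ^ j) - F (ρ ^ (j - 1)))) :
    (S.card : ℝ) - ∑ j ∈ S, (q j)⁻¹ ≤ expectedOccupancy P ρ X n := by
  refine le_trans ?_ (hX.sum_le_expectedOccupancy hρ n S)
  rw [Finset.card_eq_sum_ones, Nat.cast_sum, ← Finset.sum_sub_distrib]
  refine Finset.sum_le_sum fun j hj => ?_
  set p := F (ρ ^ j) - F (ρ ^ (j - 1)) with hp
  have hle : ρ ^ (j - 1) ≤ ρ ^ j := zpow_le_zpow_right₀ hρ.le (by omega)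
  have hp1 : p ≤ 1 := by
    rw [hp, ← hX.measureReal_bin 0 hle]
    exact measureReal_le_one
  -- The emptiness probability is at most `exp (-n p)`, and `exp (n p) ≥ n p + 1 ≥ q j`.
  have h1 : (1 - p) ^ n ≤ (q j)⁻¹ := by
    calc (1 - p) ^ n ≤ (Real.exp (-p)) ^ n :=
          pow_le_pow_left₀ (by linarith) (Real.one_sub_le_exp_neg p) n
      _ = (Real.exp (n * p))⁻¹ := by rw [← Real.exp_nat_mul, ← Real.exp_neg]; ring_nf
      _ ≤ (q j)⁻¹ := by
          apply inv_anti₀ (hq j hj)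
          have := Real.add_one_le_exp (n * p)
          linarith [hqF j hj]
  simp only [Nat.cast_one]
  linarith

end IsIIDSample

end Occupancy

end ExpHist

namespace ExpHist

/-! ### Geometric growth of expected bin counts -/

section Growth

variable {ρ : ℝ}

lemma le_zpow_ceil_logb (hρ : 1 < ρ) {x : ℝ} (hx : 0 < x) : x ≤ ρ ^ ⌈Real.logb ρ x⌉ := by
  rw [← Real.rpow_intCast, ← Real.logb_le_iff_le_rpow hρ hx]
  exact Int.le_ceil _

lemma zpow_floor_logb_le (hρ : 1 < ρ) {x : ℝ} (hx : 0 < x) : ρ ^ ⌊Real.logb ρ x⌋ ≤ x := by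
  rw [← Real.rpow_intCast, ← Real.le_logb_iff_rpow_le hρ hx]
  exact Int.floor_le _

lemma zpow_ceil_logb_le (hρ : 1 < ρ) {x : ℝ} (hx : 0 < x) : ρ ^ ⌈Real.logb ρ x⌉ ≤ ρ * x := by
  have hρ0 : 0 < ρ := by linarith
  rw [← Real.rpow_intCast, ← Real.le_logb_iff_rpow_le hρ (by positivity),
    Real.logb_mul hρ0.ne' hx.ne', Real.logb_self_eq_one hρ]
  linarith [Int.ceil_lt_add_one (Real.logb ρ x)]

/-- A geometric series of ratio `1/ρ` is controlled by its first term, uniformly in its length; this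
keeps the total emptiness probability bounded as the window grows. -/
lemma sum_inv_mul_zpow_le (hρ : 1 < ρ) {a : ℝ} (ha : 0 < a) (l u : ℤ) :
    ∑ j ∈ Finset.Icc l u, (a * ρ ^ j)⁻¹ ≤ (a * ρ ^ l)⁻¹ * (ρ / (ρ - 1)) := by
  have hρ0 : 0 < ρ := by linarith
  have hρ1 : 0 < ρ - 1 := by linarith
  rcases lt_or_ge u l with h | h
  · rw [Finset.Icc_eq_empty (by omega), Finset.sum_empty]
    positivity
  have key : ∑ j ∈ Finset.Icc l u, (a * ρ ^ j)⁻¹ =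
      ((a * ρ ^ l)⁻¹ * ρ - (a * ρ ^ u)⁻¹) / (ρ - 1) := by
    induction u, h using Int.leInduction with
    | base =>
      rw [Finset.Icc_self, Finset.sum_singleton]
      field_simp
    | succ u hu ih =>
      have hins : Finset.Icc l (u + 1) = insert (u + 1) (Finset.Icc l u) := by
        ext j
        simp only [Finset.mem_Icc, Finset.mem_insert]
        omega
      rw [hins, Finset.sum_insert (by simp), ih, zpow_add_one₀ hρ0.ne']
      field_simp
      ring
  rw [key, mul_div_assoc', div_le_div_iff_of_pos_right hρ1]
  have : 0 < (a * ρ ^ u)⁻¹ := by positivity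
  linarith

/-- Up to `ρ ^ J` the exponential density is at least `lam * exp (-(lam * ρ ^ J))`, and the bin has
width `(1 - ρ⁻¹) * ρ ^ j`. -/
lemma exp_sub_exp_ge_mul_of_le (hρ : 1 < ρ) {lam : ℝ} (hlam : 0 < lam) (J : ℤ) :
    ∃ a > 0, ∀ j ≤ J,
      a * ρ ^ j ≤ Real.exp (-(lam * ρ ^ (j - 1))) - Real.exp (-(lam * ρ ^ j)) := by
  have hρ0 : 0 < ρ := by linarith
  have hρ1 : 0 < 1 - ρ⁻¹ := by
    have := inv_lt_one_of_one_lt₀ hρ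
    linarith
  refine ⟨Real.exp (-(lam * ρ ^ J)) * (lam * (1 - ρ⁻¹)), by positivity, fun j hj => ?_⟩
  have h1 : Real.exp (-(lam * ρ ^ (j - 1))) =
      Real.exp (-(lam * ρ ^ j)) * Real.exp (lam * (1 - ρ⁻¹) * ρ ^ j) := by
    rw [← Real.exp_add, zpow_sub_one₀ hρ0.ne']
    ring_nf
  have h2 := Real.add_one_le_exp (lam * (1 - ρ⁻¹) * ρ ^ j)
  have h3 : Real.exp (-(lam * ρ ^ J)) ≤ Real.exp (-(lam * ρ ^ j)) := by
    have := zpow_le_zpow_right₀ hρ.le hj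
    apply Real.exp_le_exp.2
    nlinarith
  rw [h1]
  calc Real.exp (-(lam * ρ ^ J)) * (lam * (1 - ρ⁻¹)) * ρ ^ j
      ≤ Real.exp (-(lam * ρ ^ j)) * (lam * (1 - ρ⁻¹)) * ρ ^ j := by gcongr
    _ = Real.exp (-(lam * ρ ^ j)) * (lam * (1 - ρ⁻¹) * ρ ^ j) := by ring
    _ ≤ Real.exp (-(lam * ρ ^ j)) * (Real.exp (lam * (1 - ρ⁻¹) * ρ ^ j) - 1) := by
        gcongr
        linarith
    _ = _ := by ring

/-- With left endpoint `x = ρ ^ (j - 1)`, the bin mass is `exp (-(lam * x))` times a factor bounded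
below by a constant. Stopping at `2 * lam * x ≤ log n` instead of `lam * x ≤ log n` leaves `n * exp
(-(lam * x)) ≥ exp (lam * x) ≥ lam * x`, at the price of boundedly many bins. The `+ 1` appears
because the constraint is on the left endpoint. -/
lemma mul_exp_sub_exp_ge_of_lt (hρ : 1 < ρ) {lam : ℝ} (hlam : 0 < lam) (J : ℤ) :
    ∃ b > 0, ∀ j > J, ∀ n : ℕ, 1 < n →
      j ≤ ⌊Real.logb ρ (Real.log n / (2 * lam))⌋ + 1 →
      b * ρ ^ j ≤ n * (Real.exp (-(lam * ρ ^ (j - 1))) - Real.exp (-(lam * ρ ^ j))) := by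
  have hρ0 : 0 < ρ := by linarith
  have hρ1 : 0 < ρ - 1 := by linarith
  set d := 1 - Real.exp (-(lam * (ρ - 1) * ρ ^ J)) with hd
  have hd0 : 0 < d := by
    have : Real.exp (-(lam * (ρ - 1) * ρ ^ J)) < 1 := by
      apply Real.exp_lt_one_iff.2
      have : 0 < lam * (ρ - 1) * ρ ^ J := by positivity
      linarith
    linarith
  refine ⟨d * (lam / ρ), by positivity, fun j hj n hn hjn => ?_⟩
  have hn0 : (0 : ℝ) < n := by positivity
  have hlog : 0 < Real.log n := Real.log_pos (by exact_mod_cast hn)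
  set x := ρ ^ (j - 1) with hx
  have hx0 : 0 < x := by positivity
  have hxj : ρ ^ j = ρ * x := by
    rw [hx, zpow_sub_one₀ hρ0.ne']
    field_simp
  have hJx : ρ ^ J ≤ x := zpow_le_zpow_right₀ hρ.le (by omega)
  have hxn : 2 * (lam * x) ≤ Real.log n := by
    have h1 : x ≤ Real.log n / (2 * lam) :=
      (zpow_le_zpow_right₀ hρ.le (by omega)).trans (zpow_floor_logb_le hρ (by positivity))
    rw [le_div_iff₀ (by positivity)] at h1
    linarith
  have h2 : Real.exp (-(lam * (ρ * x))) =
      Real.exp (-(lam * x)) * Real.exp (-(lam * (ρ - 1) * x)) := by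
    rw [← Real.exp_add]
    ring_nf
  have h3 : Real.exp (-(lam * (ρ - 1) * x)) ≤ Real.exp (-(lam * (ρ - 1) * ρ ^ J)) := by
    apply Real.exp_le_exp.2
    have : lam * (ρ - 1) * ρ ^ J ≤ lam * (ρ - 1) * x := by gcongr
    linarith
  have h4 : lam * x ≤ n * Real.exp (-(lam * x)) := by
    calc lam * x ≤ Real.exp (lam * x) := by linarith [Real.add_one_le_exp (lam * x)]
      _ = Real.exp (2 * (lam * x)) * Real.exp (-(lam * x)) := by
          rw [← Real.exp_add]
          ring_nf
      _ ≤ n * Real.exp (-(lam * x)) := by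
          gcongr
          exact (Real.exp_le_exp.2 hxn).trans_eq (Real.exp_log hn0)
  rw [hxj, h2]
  calc d * (lam / ρ) * (ρ * x) = (lam * x) * d := by field_simp
    _ ≤ (n * Real.exp (-(lam * x))) * (1 - Real.exp (-(lam * (ρ - 1) * x))) := by
        gcongr
        linarith
    _ = _ := by ring

lemma IsIIDSample.sub_le_expectedOccupancy {Ω : Type*} [MeasurableSpace Ω] {P : Measure Ω}
    [IsProbabilityMeasure P] {X : ℕ → Ω → ℝ} {F : ℝ → ℝ} (hX : IsIIDSample P X F) (hρ : 1 < ρ)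
    {n : ℕ} (hn : 0 < n) {a b : ℝ} (ha : 0 < a) (hb : 0 < b) (l J k : ℤ)
    (hlo : ∀ j ∈ Finset.Icc l J, a * ρ ^ j ≤ F (ρ ^ j) - F (ρ ^ (j - 1)))
    (hhi : ∀ j ∈ Finset.Icc (J + 1) k, b * ρ ^ j ≤ n * (F (ρ ^ j) - F (ρ ^ (j - 1)))) :
    (k + 1 - l : ℝ) - ((n * a * ρ ^ l)⁻¹ + (b * ρ ^ (J + 1))⁻¹) * (ρ / (ρ - 1)) ≤
      expectedOccupancy P ρ X n := by
  have hρ0 : 0 < ρ := by linarith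
  have hn0 : (0 : ℝ) < n := by positivity
  have hdisj : Disjoint (Finset.Icc l J) (Finset.Icc (J + 1) k) := by
    rw [Finset.disjoint_left]
    intro j h1 h2
    rw [Finset.mem_Icc] at h1 h2
    omega
  set q : ℤ → ℝ := fun j => if j ≤ J then n * a * ρ ^ j else b * ρ ^ j with hq
  have hqlo : ∀ j ∈ Finset.Icc l J, q j = n * a * ρ ^ j := fun j hj => by
    simp [hq, (Finset.mem_Icc.1 hj).2]
  have hqhi : ∀ j ∈ Finset.Icc (J + 1) k, q j = b * ρ ^ j := fun j hj => by
    have : ¬ j ≤ J := by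
      have := (Finset.mem_Icc.1 hj).1
      omega
    simp [hq, this]
  have h := hX.card_sub_sum_le_expectedOccupancy hρ n (Finset.Icc l J ∪ Finset.Icc (J + 1) k)
    (q := q) (fun j _ => by
      simp only [hq]
      split_ifs <;> positivity)
    (fun j hj => by
      rcases Finset.mem_union.1 hj with hj | hj
      · rw [hqlo j hj, mul_assoc]
        exact mul_le_mul_of_nonneg_left (hlo j hj) hn0.le
      · rw [hqhi j hj]
        exact hhi j hj)
  rw [Finset.sum_union hdisj, Finset.card_union_of_disjoint hdisj, Int.card_Icc, Int.card_Icc,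
    Finset.sum_congr rfl (fun j hj => by rw [hqlo j hj]),
    Finset.sum_congr (s₁ := Finset.Icc (J + 1) k) rfl (fun j hj => by rw [hqhi j hj])] at h
  have h1 := sum_inv_mul_zpow_le hρ (a := n * a) (by positivity) l J
  have h2 := sum_inv_mul_zpow_le hρ hb (J + 1) k
  -- Truncation at zero only increases the count, so either range may be empty.
  have h3 : (k + 1 - l : ℝ) ≤ (((J + 1 - l).toNat + (k + 1 - (J + 1)).toNat : ℕ) : ℝ) := by
    have : k + 1 - l ≤ (((J + 1 - l).toNat + (k + 1 - (J + 1)).toNat : ℕ) : ℤ) := by omega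
    exact_mod_cast this
  rw [add_mul]
  linarith

lemma isBigO_one_of_eventually_le {f : ℕ → ℝ} {c d : ℝ} (h1 : ∀ᶠ n in atTop, c ≤ f n)
    (h2 : ∀ᶠ n in atTop, f n ≤ d) : f =O[atTop] (fun _ => (1 : ℝ)) := by
  refine IsBigO.of_bound (max (-c) d) ?_
  filter_upwards [h1, h2] with n hc hd
  rw [norm_one, mul_one, Real.norm_eq_abs, abs_le]
  exact ⟨by linarith [le_max_left (-c) d], hd.trans (le_max_right _ _)⟩

end Growth

/-! ### The split exponential distribution and its tails -/

section Distributions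

variable {ρ lam : ℝ}

lemma cutoff_pos (hρ : 1 < ρ) (hlam : 0 < lam) : 0 < cutoff lam ρ := by
  have := Real.log_pos hρ
  have : 0 < ρ - 1 := by linarith
  unfold cutoff
  positivity

lemma upperMass_eq (hρ : 1 < ρ) (hlam : 0 < lam) :
    upperMass ρ = Real.exp (-(lam * cutoff lam ρ)) := by
  have : 0 < ρ - 1 := by linarith
  rw [upperMass, Real.rpow_def_of_pos (by linarith), cutoff]
  congr 1
  field_simp

lemma upperMass_pos (hρ : 1 < ρ) : 0 < upperMass ρ := Real.rpow_pos_of_pos (by linarith) _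

lemma upperMass_lt_one (hρ : 1 < ρ) : upperMass ρ < 1 := by
  have : 0 < ρ - 1 := by linarith
  apply Real.rpow_lt_one_of_one_lt_of_neg hρ
  have : 0 < ρ / (ρ - 1) := by positivity
  linarith

lemma rpow_kappa (hρ : 1 < ρ) (hlam : 0 < lam) : ρ ^ kappa lam ρ = cutoff lam ρ := by
  have h1 := Real.log_pos hρ
  have h2 : 0 < ρ - 1 := by linarith
  have h3 : 0 < ρ := by linarith
  rw [kappa, Real.rpow_add h3, Real.rpow_one, Real.rpow_logb h3 hρ.ne' (by positivity), cutoff]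
  ring

lemma F0_eq (hρ : 1 < ρ) (hlam : 0 < lam) {x : ℝ} (hx : 0 ≤ x) (hxc : x ≤ cutoff lam ρ) :
    F0 lam ρ x = (1 - Real.exp (-(lam * x))) / (1 - upperMass ρ) := by
  have hu : 1 - upperMass ρ ≠ 0 := by linarith [upperMass_lt_one hρ]
  unfold F0
  split_ifs with h1 h2
  · simp [le_antisymm h1 hx]
  · rfl
  · rw [le_antisymm hxc (not_lt.1 h2), ← upperMass_eq hρ hlam, div_self hu]

lemma F0_of_cutoff_le (hρ : 1 < ρ) (hlam : 0 < lam) {x : ℝ} (hx : cutoff lam ρ ≤ x) :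
    F0 lam ρ x = 1 := by
  have := cutoff_pos hρ hlam
  rw [F0, if_neg (by linarith), if_neg (by linarith)]

lemma one_sub_exp_neg_mul_le (x : ℝ) : 1 - Real.exp (-(lam * x)) ≤ lam * x := by
  linarith [Real.one_sub_le_exp_neg (lam * x)]

lemma F0_le (hρ : 1 < ρ) (hlam : 0 < lam) {x : ℝ} (hx : 0 ≤ x) :
    F0 lam ρ x ≤ lam / (1 - upperMass ρ) * x := by
  have hu : 0 < 1 - upperMass ρ := by linarith [upperMass_lt_one hρ]
  have key : ∀ y, 0 ≤ y → y ≤ cutoff lam ρ → F0 lam ρ y ≤ lam / (1 - upperMass ρ) * y := by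
    intro y hy hyc
    rw [F0_eq hρ hlam hy hyc, div_mul_eq_mul_div]
    gcongr
    exact one_sub_exp_neg_mul_le y
  rcases le_total x (cutoff lam ρ) with h | h
  · exact key x hx h
  · have := key _ (cutoff_pos hρ hlam).le le_rfl
    rw [F0_of_cutoff_le hρ hlam le_rfl] at this
    rw [F0_of_cutoff_le hρ hlam h]
    exact this.trans (by gcongr)

lemma F1_eq {x : ℝ} (hx : cutoff lam ρ ≤ x) :
    F1 lam ρ x = 1 - Real.exp (-(lam * (x - cutoff lam ρ))) := by
  unfold F1
  split_ifs with h
  · simp [le_antisymm h hx]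
  · rfl

/-- Conditioning on exceeding the cutoff divides the exponential tail by its mass there; below the
cutoff the right side is at least one. -/
lemma one_sub_F1_le (hlam : 0 < lam) (x : ℝ) :
    1 - F1 lam ρ x ≤ Real.exp (lam * cutoff lam ρ) * Real.exp (-(lam * x)) := by
  have h : Real.exp (lam * cutoff lam ρ) * Real.exp (-(lam * x)) =
      Real.exp (-(lam * (x - cutoff lam ρ))) := by
    rw [← Real.exp_add]
    ring_nf
  rw [h]
  unfold F1
  split_ifs with h1
  · rw [sub_zero]
    apply Real.one_le_exp
    nlinarith
  · linarith

lemma exp_neg_mul_zpow_ceil_le (hρ : 1 < ρ) (hlam : 0 < lam) {n : ℕ} (hn : 1 < n) :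
    n * Real.exp (-(lam * ρ ^ ⌈Real.logb ρ (Real.log n / lam)⌉)) ≤ 1 := by
  have hn0 : (0 : ℝ) < n := by positivity
  have hlog : 0 < Real.log n := Real.log_pos (by exact_mod_cast hn)
  have h := le_zpow_ceil_logb hρ (x := Real.log n / lam) (by positivity)
  rw [div_le_iff₀ hlam] at h
  have h2 : Real.exp (-(lam * ρ ^ ⌈Real.logb ρ (Real.log n / lam)⌉)) ≤ (n : ℝ)⁻¹ := by
    rw [← Real.exp_log hn0, ← Real.exp_neg, Real.log_exp]
    apply Real.exp_le_exp.2
    linarith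
  calc _ ≤ (n : ℝ) * (n : ℝ)⁻¹ := by gcongr
    _ = 1 := mul_inv_cancel₀ hn0.ne'

lemma mul_zpow_neg_ceil_le (hρ : 1 < ρ) {n : ℕ} (hn : 0 < n) :
    n * ρ ^ (-⌈Real.logb ρ n⌉ - 1) ≤ 1 := by
  have hn0 : (0 : ℝ) < n := by positivity
  have hρ0 : 0 < ρ := by linarith
  have h : ρ ^ (-⌈Real.logb ρ n⌉ - 1) ≤ (n : ℝ)⁻¹ := by
    calc _ ≤ ρ ^ (-⌈Real.logb ρ n⌉) := zpow_le_zpow_right₀ hρ.le (by omega)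
      _ ≤ (n : ℝ)⁻¹ := by
        rw [zpow_neg]
        exact inv_anti₀ hn0 (le_zpow_ceil_logb hρ hn0)
  calc _ ≤ (n : ℝ) * (n : ℝ)⁻¹ := by gcongr
    _ = 1 := mul_inv_cancel₀ hn0.ne'

lemma inv_mul_zpow_neg_ceil_le (hρ : 1 < ρ) {n : ℕ} (hn : 0 < n) {a : ℝ} (ha : 0 < a) :
    (n * a * ρ ^ (-⌈Real.logb ρ n⌉))⁻¹ ≤ ρ / a := by
  have hn0 : (0 : ℝ) < n := by positivity
  have hρ0 : 0 < ρ := by linarith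
  have h := zpow_ceil_logb_le hρ hn0
  rw [zpow_neg, mul_inv, inv_inv, mul_inv]
  calc (n : ℝ)⁻¹ * a⁻¹ * ρ ^ ⌈Real.logb ρ n⌉ ≤ (n : ℝ)⁻¹ * a⁻¹ * (ρ * n) := by gcongr
    _ = ρ / a := by field_simp

end Distributions

end ExpHist

namespace ExpHist

/-! ### Expected occupancy up to a bounded error -/

section Asymptotics

variable {ρ lam : ℝ} {Ω : Type*} [MeasurableSpace Ω] {P : Measure Ω} [IsProbabilityMeasure P]
  {X : ℕ → Ω → ℝ}

lemma tendsto_logb_nat (hρ : 1 < ρ) : Tendsto (fun n : ℕ => Real.logb ρ n) atTop atTop :=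
  (Real.tendsto_logb_atTop hρ).comp tendsto_natCast_atTop_atTop

lemma tendsto_log_nat : Tendsto (fun n : ℕ => Real.log n) atTop atTop :=
  Real.tendsto_log_atTop.comp tendsto_natCast_atTop_atTop

lemma tendsto_logb_log_nat (hρ : 1 < ρ) :
    Tendsto (fun n : ℕ => Real.logb ρ (Real.log n)) atTop atTop :=
  (Real.tendsto_logb_atTop hρ).comp tendsto_log_nat

theorem IsIIDSample.expectedOccupancy_sub_logb_isBigO
    (hX : IsIIDSample P X (F0 lam ρ)) (hρ : 1 < ρ) (hlam : 0 < lam) :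
    (fun n : ℕ => expectedOccupancy P ρ X n - Real.logb ρ n) =O[atTop] (fun _ => (1 : ℝ)) := by
  have hρ0 : 0 < ρ := by linarith
  have hu : 0 < 1 - upperMass ρ := by linarith [upperMass_lt_one hρ]
  have hc := cutoff_pos hρ hlam
  set J := ⌊Real.logb ρ (cutoff lam ρ)⌋
  set U := ⌈Real.logb ρ (cutoff lam ρ)⌉
  obtain ⟨a, ha, haj⟩ := exp_sub_exp_ge_mul_of_le hρ hlam J
  refine isBigO_one_of_eventually_le
    (c := J + 1 - ((ρ / (a / (1 - upperMass ρ))) + (1 * ρ ^ (J + 1))⁻¹) * (ρ / (ρ - 1)))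
    (d := U + 2 + lam / (1 - upperMass ρ)) ?_ ?_
  · filter_upwards [eventually_gt_atTop 0] with n hn
    -- Taking `k = J` makes the upper range empty, so `b = 1` is arbitrary.
    have h := hX.sub_le_expectedOccupancy hρ hn (a := a / (1 - upperMass ρ)) (b := 1)
      (by positivity) one_pos (-⌈Real.logb ρ n⌉) J J
      (fun j hj => by
        have hj2 := (Finset.mem_Icc.1 hj).2
        have hJ := zpow_floor_logb_le hρ hc
        rw [F0_eq hρ hlam (by positivity) ((zpow_le_zpow_right₀ hρ.le hj2).trans hJ),
          F0_eq hρ hlam (by positivity)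
            ((zpow_le_zpow_right₀ hρ.le (by omega)).trans hJ), ← sub_div, div_mul_eq_mul_div]
        gcongr
        linarith [haj j hj2])
      (fun j hj => by
        have := Finset.mem_Icc.1 hj
        omega)
    have h1 := inv_mul_zpow_neg_ceil_le hρ hn (a := a / (1 - upperMass ρ)) (by positivity)
    have h2 := Int.le_ceil (Real.logb ρ n)
    have h3 : 0 < ρ / (ρ - 1) := div_pos hρ0 (by linarith)
    have h4 := mul_le_mul_of_nonneg_right h1 h3.le
    push_cast at h
    rw [add_mul] at h ⊢
    linarith
  · filter_upwards [eventually_gt_atTop 0, (tendsto_logb_nat hρ).eventually_ge_atTop (-U - 1)]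
      with n hn hnU
    have h0 := Int.le_ceil (Real.logb ρ n)
    have h := hX.expectedOccupancy_le_add hρ n (L := -⌈Real.logb ρ n⌉) (U := U) (by
      have : (-U - 1 : ℝ) ≤ ⌈Real.logb ρ n⌉ := hnU.trans h0
      have : -U - 1 ≤ ⌈Real.logb ρ n⌉ := by exact_mod_cast this
      omega)
    rw [F0_of_cutoff_le hρ hlam (le_zpow_ceil_logb hρ hc)] at h
    have h1 : n * F0 lam ρ (ρ ^ (-⌈Real.logb ρ n⌉ - 1)) ≤ lam / (1 - upperMass ρ) := by
      calc _ ≤ n * (lam / (1 - upperMass ρ) * ρ ^ (-⌈Real.logb ρ n⌉ - 1)) := by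
            gcongr
            exact F0_le hρ hlam (by positivity)
        _ = lam / (1 - upperMass ρ) * (n * ρ ^ (-⌈Real.logb ρ n⌉ - 1)) := by ring
        _ ≤ lam / (1 - upperMass ρ) * 1 := by
            gcongr
            exact mul_zpow_neg_ceil_le hρ hn
        _ = _ := mul_one _
    have h2 := Int.ceil_lt_add_one (Real.logb ρ n)
    push_cast at h
    linarith

lemma logb_div_const {b : ℝ} (hb : 0 < b) {n : ℕ} (hn : 1 < n) :
    Real.logb ρ (Real.log n / b) = Real.logb ρ (Real.log n) - Real.logb ρ b :=
  Real.logb_div (Real.log_pos (by exact_mod_cast hn)).ne' hb.ne'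

theorem IsIIDSample.expectedOccupancy_sub_logb_log_isBigO
    (hX : IsIIDSample P X (F1 lam ρ)) (hρ : 1 < ρ) (hlam : 0 < lam) :
    (fun n : ℕ => expectedOccupancy P ρ X n - Real.logb ρ (Real.log n)) =O[atTop]
      (fun _ => (1 : ℝ)) := by
  have hρ0 : 0 < ρ := by linarith
  have hc := cutoff_pos hρ hlam
  set J := ⌈Real.logb ρ (cutoff lam ρ)⌉
  set L := ⌊Real.logb ρ (cutoff lam ρ)⌋
  obtain ⟨b, hb, hbj⟩ := mul_exp_sub_exp_ge_of_lt hρ hlam J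
  refine isBigO_one_of_eventually_le
    (c := -Real.logb ρ (2 * lam) - J - ((ρ ^ (J + 1))⁻¹ + (b * ρ ^ (J + 1))⁻¹) * (ρ / (ρ - 1)))
    (d := -Real.logb ρ lam + 1 - L + Real.exp (lam * cutoff lam ρ)) ?_ ?_
  · filter_upwards [eventually_gt_atTop 1] with n hn
    have hn1 : (1 : ℝ) ≤ n := by exact_mod_cast hn.le
    -- Taking `l = J + 1` makes the lower range empty, so `a = 1` is arbitrary.
    have h := hX.sub_le_expectedOccupancy hρ (by omega : 0 < n) (a := 1) (b := b)
      one_pos hb (J + 1) J (⌊Real.logb ρ (Real.log n / (2 * lam))⌋ + 1)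
      (fun j hj => by
        have := Finset.mem_Icc.1 hj
        omega)
      (fun j hj => by
        have hj2 := Finset.mem_Icc.1 hj
        have hJ := le_zpow_ceil_logb hρ hc
        refine (hbj j (by omega) n hn hj2.2).trans ?_
        refine mul_le_mul_of_nonneg_left ?_ (Nat.cast_nonneg _)
        rw [F1_eq (hJ.trans (zpow_le_zpow_right₀ hρ.le (by omega : J ≤ j))),
          F1_eq (hJ.trans (zpow_le_zpow_right₀ hρ.le (by omega : J ≤ j - 1)))]
        have e : ∀ x, Real.exp (-(lam * (x - cutoff lam ρ))) =
            Real.exp (lam * cutoff lam ρ) * Real.exp (-(lam * x)) := fun x => by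
          rw [← Real.exp_add]
          ring_nf
        rw [e, e]
        have h1 : 1 ≤ Real.exp (lam * cutoff lam ρ) := Real.one_le_exp (by positivity)
        have h2 : 0 ≤ Real.exp (-(lam * ρ ^ (j - 1))) - Real.exp (-(lam * ρ ^ j)) := by
          have : ρ ^ (j - 1) ≤ ρ ^ j := zpow_le_zpow_right₀ hρ.le (by omega)
          have : Real.exp (-(lam * ρ ^ j)) ≤ Real.exp (-(lam * ρ ^ (j - 1))) := by
            apply Real.exp_le_exp.2
            nlinarith
          linarith
        nlinarith)
    have h1 : (n * 1 * ρ ^ (J + 1))⁻¹ ≤ (ρ ^ (J + 1))⁻¹ := by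
      apply inv_anti₀ (by positivity)
      have : 0 < ρ ^ (J + 1) := by positivity
      nlinarith
    have h2 := Int.lt_floor_add_one (Real.logb ρ (Real.log n / (2 * lam)))
    rw [logb_div_const (by positivity) hn] at h2 h
    have h3 : 0 < ρ / (ρ - 1) := div_pos hρ0 (by linarith)
    have h4 := mul_le_mul_of_nonneg_right h1 h3.le
    push_cast at h
    rw [add_mul] at h ⊢
    linarith
  · filter_upwards [eventually_gt_atTop 1,
      (tendsto_logb_log_nat hρ).eventually_ge_atTop (L + Real.logb ρ lam)] with n hn hnU
    have h0 := Int.le_ceil (Real.logb ρ (Real.log n / lam))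
    have h := hX.expectedOccupancy_le_add hρ n (L := L + 1)
      (U := ⌈Real.logb ρ (Real.log n / lam)⌉) (by
      rw [logb_div_const hlam hn] at h0 ⊢
      have : (L : ℝ) ≤ ⌈Real.logb ρ (Real.log n) - Real.logb ρ lam⌉ := by linarith
      have : L ≤ ⌈Real.logb ρ (Real.log n) - Real.logb ρ lam⌉ := by exact_mod_cast this
      omega)
    have h1 : n * (1 - F1 lam ρ (ρ ^ ⌈Real.logb ρ (Real.log n / lam)⌉)) ≤
        Real.exp (lam * cutoff lam ρ) := by
      calc _ ≤ n * (Real.exp (lam * cutoff lam ρ) *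
              Real.exp (-(lam * ρ ^ ⌈Real.logb ρ (Real.log n / lam)⌉))) := by
            gcongr
            exact one_sub_F1_le hlam _
        _ = Real.exp (lam * cutoff lam ρ) *
              (n * Real.exp (-(lam * ρ ^ ⌈Real.logb ρ (Real.log n / lam)⌉))) := by ring
        _ ≤ Real.exp (lam * cutoff lam ρ) * 1 := by
            gcongr
            exact exp_neg_mul_zpow_ceil_le hρ hlam hn
        _ = _ := mul_one _
    -- Since `ρ ^ L` does not exceed the cutoff, no mass lies below the window.
    have h2 : F1 lam ρ (ρ ^ (L + 1 - 1)) = 0 := by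
      rw [add_sub_cancel_right, F1, if_pos (zpow_floor_logb_le hρ hc)]
    rw [h2] at h
    have h3 := Int.ceil_lt_add_one (Real.logb ρ (Real.log n / lam))
    rw [logb_div_const hlam hn] at h h1 h3
    push_cast at h
    linarith

lemma cdf_exp_eq (hlam : 0 < lam) {x : ℝ} (hx : 0 ≤ x) :
    cdf (expMeasure lam) x = 1 - Real.exp (-(lam * x)) := by
  rw [cdf_expMeasure_eq hlam, if_pos hx]

theorem IsIIDSample.expectedOccupancy_exp_isBigO
    (hX : IsIIDSample P X (cdf (expMeasure lam))) (hρ : 1 < ρ) (hlam : 0 < lam) :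
    (fun n : ℕ => expectedOccupancy P ρ X n - (Real.logb ρ n + Real.logb ρ (Real.log n)))
      =O[atTop] (fun _ => (1 : ℝ)) := by
  have hρ0 : 0 < ρ := by linarith
  obtain ⟨a, ha, haj⟩ := exp_sub_exp_ge_mul_of_le hρ hlam 0
  obtain ⟨b, hb, hbj⟩ := mul_exp_sub_exp_ge_of_lt hρ hlam 0
  have hcdf : ∀ j : ℤ, cdf (expMeasure lam) (ρ ^ j) = 1 - Real.exp (-(lam * ρ ^ j)) :=
    fun j => cdf_exp_eq hlam (by positivity)
  have hinc : ∀ j : ℤ, cdf (expMeasure lam) (ρ ^ j) - cdf (expMeasure lam) (ρ ^ (j - 1)) =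
      Real.exp (-(lam * ρ ^ (j - 1))) - Real.exp (-(lam * ρ ^ j)) := fun j => by
    rw [hcdf, hcdf]
    ring
  refine isBigO_one_of_eventually_le
    (c := 1 - Real.logb ρ (2 * lam) - (ρ / a + (b * ρ ^ (0 + 1 : ℤ))⁻¹) * (ρ / (ρ - 1)))
    (d := 3 - Real.logb ρ lam + lam + 1) ?_ ?_
  · filter_upwards [eventually_gt_atTop 1] with n hn
    have h := hX.sub_le_expectedOccupancy hρ (by omega : 0 < n) ha hb
      (-⌈Real.logb ρ n⌉) 0 (⌊Real.logb ρ (Real.log n / (2 * lam))⌋ + 1)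
      (fun j hj => (haj j (Finset.mem_Icc.1 hj).2).trans_eq (hinc j).symm)
      (fun j hj => by
        have hj2 := Finset.mem_Icc.1 hj
        rw [hinc]
        exact hbj j (by omega) n hn hj2.2)
    have h1 := inv_mul_zpow_neg_ceil_le hρ (by omega : 0 < n) ha
    have h2 := Int.lt_floor_add_one (Real.logb ρ (Real.log n / (2 * lam)))
    have h5 := Int.le_ceil (Real.logb ρ n)
    rw [logb_div_const (by positivity) hn] at h2 h
    have h3 : 0 < ρ / (ρ - 1) := div_pos hρ0 (by linarith)
    have h4 := mul_le_mul_of_nonneg_right h1 h3.le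
    push_cast at h
    rw [add_mul] at h ⊢
    linarith
  · filter_upwards [eventually_gt_atTop 1, (tendsto_logb_nat hρ).eventually_ge_atTop 0,
      (tendsto_logb_log_nat hρ).eventually_ge_atTop (Real.logb ρ lam)] with n hn hnL hnU
    have h0 := Int.le_ceil (Real.logb ρ (Real.log n / lam))
    have h0' := Int.le_ceil (Real.logb ρ n)
    have h := hX.expectedOccupancy_le_add hρ n (L := -⌈Real.logb ρ n⌉)
      (U := ⌈Real.logb ρ (Real.log n / lam)⌉) (by
      rw [logb_div_const hlam hn] at h0 ⊢
      have : (0 : ℝ) ≤ ⌈Real.logb ρ (Real.log n) - Real.logb ρ lam⌉ := by linarith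
      have h6 : 0 ≤ ⌈Real.logb ρ (Real.log n) - Real.logb ρ lam⌉ := by exact_mod_cast this
      have : (0 : ℝ) ≤ ⌈Real.logb ρ n⌉ := by linarith
      have h7 : 0 ≤ ⌈Real.logb ρ n⌉ := by exact_mod_cast this
      omega)
    have h1 := exp_neg_mul_zpow_ceil_le hρ hlam hn
    have h2 : n * (1 - Real.exp (-(lam * ρ ^ (-⌈Real.logb ρ n⌉ - 1)))) ≤ lam := by
      calc _ ≤ n * (lam * ρ ^ (-⌈Real.logb ρ n⌉ - 1)) := by
            gcongr
            exact one_sub_exp_neg_mul_le _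
        _ = lam * (n * ρ ^ (-⌈Real.logb ρ n⌉ - 1)) := by ring
        _ ≤ lam * 1 := by
            gcongr
            exact mul_zpow_neg_ceil_le hρ (by omega)
        _ = _ := mul_one _
    rw [hcdf, hcdf, sub_sub_cancel] at h
    have h3 := Int.ceil_lt_add_one (Real.logb ρ (Real.log n / lam))
    have h4 := Int.ceil_lt_add_one (Real.logb ρ n)
    rw [logb_div_const hlam hn] at h h1 h3
    push_cast at h
    linarith

end Asymptotics

end ExpHist

namespace ExpHist

/-! ### Existence and bounds for the Lambert branches -/

section Lambert

lemma lambertW0_mem_Icc {x : ℝ} (h1 : -Real.exp (-1) ≤ x) (h2 : x ≤ 0) :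
    lambertW0 x ∈ Set.Icc (-1) 0 := by
  have hex : ∃ w ∈ Set.Ici (-1 : ℝ), w * Real.exp w = x := by
    have hcont : ContinuousOn (fun w : ℝ => w * Real.exp w) (Set.Icc (-1) 0) := by fun_prop
    obtain ⟨w, hw, hwx⟩ := intermediate_value_Icc (by norm_num) hcont
      (show x ∈ Set.Icc _ _ from ⟨by simpa using h1, by simpa using h2⟩)
    exact ⟨w, hw.1, hwx⟩
  obtain ⟨hmem, heq⟩ := Function.invFunOn_pos hex
  refine ⟨hmem, ?_⟩
  by_contra! hpos
  have heq' : lambertW0 x * Real.exp (lambertW0 x) = x := heq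
  have := mul_pos hpos (Real.exp_pos (lambertW0 x))
  linarith

lemma lambertWm1_spec {x : ℝ} (hx : x ∈ Set.Ico (-Real.exp (-1)) 0) :
    lambertWm1 x ≤ -1 ∧ lambertWm1 x * Real.exp (lambertWm1 x) = x := by
  refine Function.invFunOn_pos (s := Set.Iic (-1 : ℝ)) (f := fun w : ℝ => w * Real.exp w) ?_
  obtain ⟨h1, h2⟩ := hx
  have hx0 : 0 < -x := by linarith
  set t := -Real.log (-x) with ht
  have hxt : x = -Real.exp (-t) := by rw [ht, neg_neg, Real.exp_log hx0, neg_neg]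
  have ht1 : 1 ≤ t := by
    have : Real.log (-x) ≤ -1 := by
      rw [Real.log_le_iff_le_exp hx0]
      linarith
    linarith
  have hcont : ContinuousOn (fun w : ℝ => w * Real.exp w) (Set.Icc (-(2 * t)) (-1)) := by fun_prop
  -- With `x = -exp (-t)` this says `2 * t ≤ exp t`, which follows from `1 + t + t ^ 2 / 2 ≤ exp t`.
  have hleft : x ≤ -(2 * t) * Real.exp (-(2 * t)) := by
    have h3 := Real.quadratic_le_exp_of_nonneg (by linarith : 0 ≤ t)
    have h4 : Real.exp (-t) = Real.exp t * Real.exp (-(2 * t)) := by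
      rw [← Real.exp_add]
      ring_nf
    rw [hxt, h4]
    nlinarith [Real.exp_pos (-(2 * t)), sq_nonneg (t - 1)]
  obtain ⟨w, hw, hwx⟩ := intermediate_value_Icc' (by linarith) hcont
    (show x ∈ Set.Icc _ _ from ⟨by simpa using h1, hleft⟩)
  exact ⟨w, hw.2, hwx⟩

/-- For `s = log w ≥ 0`, `w = exp s ≥ 1 + s + s ^ 2 / 2` gives `η - 1 ≥ s ^ 2 / 2`, which bounds
`s`. -/
lemma le_add_sqrt_of_sub_log_eq {w η : ℝ} (hw : 1 ≤ w) (h : w - Real.log w = η) :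
    w ≤ η + √(2 * (η - 1)) := by
  have hlog : 0 ≤ Real.log w := Real.log_nonneg hw
  have h1 := Real.quadratic_le_exp_of_nonneg hlog
  rw [Real.exp_log (by linarith)] at h1
  have h2 : Real.log w ≤ √(2 * (η - 1)) := by
    apply Real.le_sqrt_of_sq_le
    linarith
  linarith

end Lambert

/-! ### The closed-form approximations and the effect of rounding -/

section Approximations

variable {ρ : ℝ}

lemma isEquivalent_of_sub_isBigO_one {f g : ℕ → ℝ}
    (h : (fun n => f n - g n) =O[atTop] (fun _ => (1 : ℝ))) (hg : Tendsto g atTop atTop) :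
    f ~[atTop] g :=
  h.trans_isLittleO (isLittleO_const_left.2 (Or.inr (tendsto_norm_atTop_atTop.comp hg)))

/-- The logarithm turns constant factors into bounded differences, so crude two-sided bounds suffice
below. -/
lemma logb_sub_logb_isBigO_one (hρ : 1 < ρ) {f g : ℕ → ℝ} {a b : ℝ} (ha : 0 < a)
    (hg : ∀ᶠ n in atTop, 0 < g n) (h : ∀ᶠ n in atTop, a * g n ≤ f n ∧ f n ≤ b * g n) :
    (fun n => Real.logb ρ (f n) - Real.logb ρ (g n)) =O[atTop] (fun _ => (1 : ℝ)) := by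
  refine isBigO_one_of_eventually_le (c := Real.logb ρ a) (d := Real.logb ρ b) ?_ ?_
  · filter_upwards [hg, h] with n hn hf
    have h1 := Real.logb_le_logb_of_le hρ (by positivity) hf.1
    rw [Real.logb_mul ha.ne' hn.ne'] at h1
    linarith
  · filter_upwards [hg, h] with n hn hf
    have h0 : 0 < a * g n := by positivity
    have hb : 0 < b := pos_of_mul_pos_left (h0.trans_le (hf.1.trans hf.2)) hn.le
    have h1 := Real.logb_le_logb_of_le hρ (h0.trans_le hf.1) hf.2
    rw [Real.logb_mul hb.ne' hn.ne'] at h1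
    linarith

lemma eventually_log_nat_pos : ∀ᶠ n : ℕ in atTop, 0 < Real.log n :=
  tendsto_log_nat.eventually_gt_atTop 0

theorem approx0_sub_logb_isBigO (hρ : 1 < ρ) :
    (fun n : ℕ => approx0 ρ n - Real.logb ρ n) =O[atTop] (fun _ => (1 : ℝ)) := by
  have hlog := Real.log_pos hρ
  have hρ0 : 0 < ρ := by linarith
  have hρ1 : 0 < ρ - 1 := by linarith
  have hu : 0 < 1 - upperMass ρ := by linarith [upperMass_lt_one hρ]
  have hmem : ∀ᶠ n : ℕ in atTop,
      lambertW0 (-((1 - upperMass ρ) * √ρ / ((ρ - 1) * n))) ∈ Set.Icc (-1) 0 := by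
    have ht : Tendsto (fun n : ℕ => -((1 - upperMass ρ) * √ρ / ((ρ - 1) * n))) atTop (𝓝 (-0)) :=
      (tendsto_const_nhds.div_atTop
        (tendsto_natCast_atTop_atTop.const_mul_atTop hρ1)).neg
    filter_upwards [ht.eventually_const_le (u := -Real.exp (-1)) (by simp [Real.exp_pos])] with n hn
    refine lambertW0_mem_Icc hn ?_
    have : 0 ≤ (1 - upperMass ρ) * √ρ / ((ρ - 1) * n) := by positivity
    linarith
  have h : ∀ᶠ n : ℕ in atTop, approx0 ρ n - Real.logb ρ n =
      Real.logb ρ (Real.log ρ / (1 - upperMass ρ)) +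
        1 / Real.log ρ * lambertW0 (-((1 - upperMass ρ) * √ρ / ((ρ - 1) * n))) := by
    filter_upwards [eventually_gt_atTop 0] with n hn
    rw [approx0, mul_div_assoc, Real.logb_mul (by positivity) (by positivity)]
    ring
  have hpos : 0 < 1 / Real.log ρ := by positivity
  refine isBigO_one_of_eventually_le
    (c := Real.logb ρ (Real.log ρ / (1 - upperMass ρ)) + 1 / Real.log ρ * (-1))
    (d := Real.logb ρ (Real.log ρ / (1 - upperMass ρ)) + 1 / Real.log ρ * 0) ?_ ?_
  · filter_upwards [h, hmem] with n hn hw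
    rw [hn]
    gcongr
    exact hw.1
  · filter_upwards [h, hmem] with n hn hw
    rw [hn]
    gcongr
    exact hw.2

lemma arg1_eventually_mem (hρ : 1 < ρ) :
    ∀ᶠ n : ℕ in atTop, arg1 ρ n ∈ Set.Ico (-Real.exp (-1)) 0 := by
  have hlog := Real.log_pos hρ
  have hu := upperMass_pos hρ
  have ht : Tendsto (fun n : ℕ => arg1 ρ n) atTop (𝓝 (-0)) :=
    (tendsto_const_nhds.div_atTop
      (tendsto_natCast_atTop_atTop.atTop_mul_const hlog)).neg
  filter_upwards [ht.eventually_const_le (u := -Real.exp (-1)) (by simp [Real.exp_pos]),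
    eventually_gt_atTop 0] with n hn hn0
  refine ⟨hn, ?_⟩
  have : 0 < upperMass ρ / (n * Real.log ρ) := by positivity
  rw [arg1]
  linarith

/-- Take logarithms in `-W * exp W = u / (n * log ρ)`; the logarithm of the right side is `-eta ρ
n`. -/
lemma neg_lambertWm1_arg1 (hρ : 1 < ρ) {n : ℕ} (h : arg1 ρ n ∈ Set.Ico (-Real.exp (-1)) 0) :
    1 ≤ -lambertWm1 (arg1 ρ n) ∧
      -lambertWm1 (arg1 ρ n) - Real.log (-lambertWm1 (arg1 ρ n)) = eta ρ n := by
  have hlog := Real.log_pos hρ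
  have hu := upperMass_pos hρ
  -- At `n = 0` division by zero makes `arg1` equal to `0`, which the half-open interval excludes.
  have hn : (n : ℝ) ≠ 0 := by
    rintro h0
    have := h.2
    simp [arg1, h0] at this
  obtain ⟨h1, h2⟩ := lambertWm1_spec h
  set W := lambertWm1 (arg1 ρ n)
  refine ⟨by linarith, ?_⟩
  have h3 : -W * Real.exp W = upperMass ρ / (n * Real.log ρ) := by
    rw [neg_mul, h2, arg1, neg_neg]
  have h4 := congrArg Real.log h3
  rw [Real.log_mul (by linarith) (Real.exp_pos W).ne', Real.log_exp,
    Real.log_div hu.ne' (mul_ne_zero hn hlog.ne'), upperMass, Real.log_rpow (by linarith)] at h4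
  rw [eta]
  have : ρ * Real.log ρ / (ρ - 1) = ρ / (ρ - 1) * Real.log ρ := by ring
  linarith

theorem approx1_le_bound1 (hρ : 1 < ρ) {n : ℕ} (h : arg1 ρ n ∈ Set.Ico (-Real.exp (-1)) 0) :
    approx1 ρ n ≤ bound1 ρ n := by
  have hlog := Real.log_pos hρ
  have hρ1 : 0 < ρ - 1 := by linarith
  obtain ⟨h1, h2⟩ := neg_lambertWm1_arg1 hρ h
  rw [approx1, bound1, ← mul_neg]
  have h0 : 0 < -lambertWm1 (arg1 ρ n) := by linarith
  apply Real.logb_le_logb_of_le hρ (by positivity)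
  gcongr
  exact le_add_sqrt_of_sub_log_eq h1 h2

lemma eta_eventually_mem (hρ : 1 < ρ) : ∀ᶠ n : ℕ in atTop,
    1 ≤ eta ρ n ∧ 1 / 2 * Real.log n ≤ eta ρ n ∧ eta ρ n ≤ 2 * Real.log n := by
  have hlog := Real.log_pos hρ
  set K := Real.log (Real.log ρ) + ρ * Real.log ρ / (ρ - 1)
  filter_upwards [eventually_gt_atTop 0, tendsto_log_nat.eventually_ge_atTop (1 - K),
    tendsto_log_nat.eventually_ge_atTop (-2 * K), tendsto_log_nat.eventually_ge_atTop K]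
    with n hn h1 h2 h3
  have : eta ρ n = Real.log n + K := by
    rw [eta, Real.log_mul (by positivity) hlog.ne']
    ring
  rw [this]
  refine ⟨?_, ?_, ?_⟩ <;> linarith

lemma add_sqrt_le_two_mul {η : ℝ} (hη : 1 ≤ η) : η + √(2 * (η - 1)) ≤ 2 * η := by
  have : √(2 * (η - 1)) ≤ η := by
    rw [Real.sqrt_le_left (by linarith)]
    nlinarith [sq_nonneg (η - 1)]
  linarith

theorem approx1_sub_logb_log_isBigO (hρ : 1 < ρ) :
    (fun n : ℕ => approx1 ρ n - Real.logb ρ (Real.log n)) =O[atTop] (fun _ => (1 : ℝ)) := by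
  have hlog := Real.log_pos hρ
  have hρ1 : 0 < ρ - 1 := by linarith
  have hc : 0 < (ρ - 1) / Real.log ρ := by positivity
  refine logb_sub_logb_isBigO_one hρ (a := (ρ - 1) / Real.log ρ * (1 / 2))
    (b := (ρ - 1) / Real.log ρ * 4) (by positivity) eventually_log_nat_pos ?_
  filter_upwards [arg1_eventually_mem hρ, eta_eventually_mem hρ] with n hn hη
  obtain ⟨h1, h2⟩ := neg_lambertWm1_arg1 hρ hn
  have h3 := le_add_sqrt_of_sub_log_eq h1 h2
  have h4 := add_sqrt_le_two_mul hη.1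
  have h5 := Real.log_nonneg h1
  rw [← mul_neg, mul_assoc, mul_assoc]
  -- Here `η ≤ w ≤ 2η` and `(log n)/2 ≤ η ≤ 2 log n`, whence the factors `1/2` and `4`.
  constructor <;> refine mul_le_mul_of_nonneg_left ?_ hc.le <;> linarith [hη.2.1, hη.2.2]

theorem bound1_sub_logb_log_isBigO (hρ : 1 < ρ) :
    (fun n : ℕ => bound1 ρ n - Real.logb ρ (Real.log n)) =O[atTop] (fun _ => (1 : ℝ)) := by
  have hlog := Real.log_pos hρ
  have hρ1 : 0 < ρ - 1 := by linarith
  have hc : 0 < (ρ - 1) / Real.log ρ := by positivity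
  refine logb_sub_logb_isBigO_one hρ (a := (ρ - 1) / Real.log ρ * (1 / 2))
    (b := (ρ - 1) / Real.log ρ * 4) (by positivity) eventually_log_nat_pos ?_
  filter_upwards [eta_eventually_mem hρ] with n hη
  have h4 := add_sqrt_le_two_mul hη.1
  have h5 := Real.sqrt_nonneg (2 * (eta ρ n - 1))
  rw [mul_assoc, mul_assoc]
  constructor <;> refine mul_le_mul_of_nonneg_left ?_ hc.le <;> linarith [hη.2.1, hη.2.2]

lemma logb_logb_sub_logb_log_isBigO (hρ : 1 < ρ) :
    (fun n : ℕ => Real.logb ρ (Real.logb ρ n) - Real.logb ρ (Real.log n)) =O[atTop]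
      (fun _ => (1 : ℝ)) := by
  have hlog := Real.log_pos hρ
  refine logb_sub_logb_isBigO_one hρ (a := 1 / Real.log ρ) (b := 1 / Real.log ρ) (by positivity)
    eventually_log_nat_pos (Eventually.of_forall fun n => ?_)
  have : Real.logb ρ n = 1 / Real.log ρ * Real.log n := by
    rw [Real.logb]
    ring
  exact ⟨this.ge, this.le⟩

lemma logb_log_isLittleO_logb (hρ : 1 < ρ) :
    (fun n : ℕ => Real.logb ρ (Real.log n)) =o[atTop] (fun n : ℕ => Real.logb ρ n) := by
  have hlog := (Real.log_pos hρ).ne'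
  have h : (fun n : ℕ => Real.log (Real.log n)) =o[atTop] (fun n : ℕ => Real.log n) :=
    Real.isLittleO_log_id_atTop.comp_tendsto tendsto_log_nat
  simp only [Real.logb, div_eq_mul_inv]
  exact (h.mul_isBigO (isBigO_refl (fun _ : ℕ => (Real.log ρ)⁻¹) atTop))

/-- Sequences of naturals within distance one of `c * n`. -/
lemma rounded_eventually_mem {c : ℝ} (hc : 0 < c) (hc1 : c < 1) {a : ℕ → ℕ}
    (ha : ∀ n, |(a n : ℝ) - n * c| < 1) :
    ∀ᶠ n : ℕ in atTop, c / 2 * n ≤ a n ∧ (a n : ℝ) ≤ 2 * n := by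
  filter_upwards [tendsto_natCast_atTop_atTop.eventually_ge_atTop (2 / c),
    eventually_ge_atTop 1] with n hn hn1
  rw [div_le_iff₀ hc] at hn
  have h := abs_lt.1 (ha n)
  have h1 : (1 : ℝ) ≤ n := by exact_mod_cast hn1
  constructor <;> nlinarith

lemma rounded_tendsto {c : ℝ} (hc : 0 < c) (hc1 : c < 1) {a : ℕ → ℕ}
    (ha : ∀ n, |(a n : ℝ) - n * c| < 1) : Tendsto a atTop atTop := by
  rw [← tendsto_natCast_atTop_iff (R := ℝ)]
  refine tendsto_atTop_mono' _ ?_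
    (tendsto_natCast_atTop_atTop.const_mul_atTop (by positivity : 0 < c / 2))
  filter_upwards [rounded_eventually_mem hc hc1 ha] with n hn using hn.1

lemma logb_rounded_isBigO (hρ : 1 < ρ) {c : ℝ} (hc : 0 < c) (hc1 : c < 1) {a : ℕ → ℕ}
    (ha : ∀ n, |(a n : ℝ) - n * c| < 1) :
    (fun n => Real.logb ρ (a n) - Real.logb ρ n) =O[atTop] (fun _ => (1 : ℝ)) := by
  refine logb_sub_logb_isBigO_one hρ (a := c / 2) (b := 2) (by positivity) ?_
    (rounded_eventually_mem hc hc1 ha)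
  filter_upwards [eventually_gt_atTop 0] with n hn
  exact_mod_cast hn

lemma logb_log_rounded_isBigO (hρ : 1 < ρ) {c : ℝ} (hc : 0 < c) (hc1 : c < 1) {a : ℕ → ℕ}
    (ha : ∀ n, |(a n : ℝ) - n * c| < 1) :
    (fun n => Real.logb ρ (Real.log (a n)) - Real.logb ρ (Real.log n)) =O[atTop]
      (fun _ => (1 : ℝ)) := by
  refine logb_sub_logb_isBigO_one hρ (a := 1 / 2) (b := 2) (by positivity)
    eventually_log_nat_pos ?_
  filter_upwards [rounded_eventually_mem hc hc1 ha, eventually_gt_atTop 0,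
    tendsto_log_nat.eventually_ge_atTop (-2 * Real.log (c / 2)),
    tendsto_log_nat.eventually_ge_atTop (Real.log 2)] with n hn hn0 h1 h2
  have hn0' : (0 : ℝ) < n := by exact_mod_cast hn0
  have h3 := Real.log_le_log (by positivity) hn.1
  have h4 := Real.log_le_log ((by positivity : 0 < c / 2 * n).trans_le hn.1) hn.2
  rw [Real.log_mul (by positivity) hn0'.ne'] at h3 h4
  constructor <;> linarith

end Approximations

end ExpHist

/-! ### Assembly of the theorem -/

open Classical in
theorem mainTheorem11 (ρ lam : ℝ) (hρ : 1 < ρ) (hlam : 0 < lam)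
    {Ω₀ Ω₁ Ω : Type*} [MeasurableSpace Ω₀] [MeasurableSpace Ω₁] [MeasurableSpace Ω]
    (P₀ : Measure Ω₀) (P₁ : Measure Ω₁) (P : Measure Ω)
    [IsProbabilityMeasure P₀] [IsProbabilityMeasure P₁] [IsProbabilityMeasure P]
    (X₀ : ℕ → Ω₀ → ℝ) (X₁ : ℕ → Ω₁ → ℝ) (X : ℕ → Ω → ℝ)
    (hX₀ : ExpHist.IsIIDSample P₀ X₀ (ExpHist.F0 lam ρ))
    (hX₁ : ExpHist.IsIIDSample P₁ X₁ (ExpHist.F1 lam ρ))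
    (hX : ExpHist.IsIIDSample P X (cdf (expMeasure lam))) :
    -- (1) samples from the lower part
    ((fun n : ℕ => ExpHist.expectedOccupancy P₀ ρ X₀ n) ~[atTop]
        (fun n : ℕ => ExpHist.approx0 ρ n) ∧
      (fun n : ℕ => ExpHist.approx0 ρ n) ~[atTop] (fun n : ℕ => Real.logb ρ n)) ∧
    -- (2) samples from the upper part
    ((fun n : ℕ => ExpHist.expectedOccupancy P₁ ρ X₁ n) ~[atTop]
        (fun n : ℕ => ExpHist.approx1 ρ n) ∧
      (∀ᶠ n : ℕ in atTop, ExpHist.arg1 ρ n ∈ Set.Ico (-Real.exp (-1)) 0) ∧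
      (∀ n : ℕ, ExpHist.arg1 ρ n ∈ Set.Ico (-Real.exp (-1)) 0 →
        ExpHist.approx1 ρ n ≤ ExpHist.bound1 ρ n) ∧
      (fun n : ℕ => ExpHist.bound1 ρ n) ~[atTop]
        (fun n : ℕ => Real.logb ρ (Real.logb ρ n))) ∧
    -- (3) samples from the whole exponential distribution; `a n` and `b n` are the expected numbers
    -- of values below and above the cutoff, rounded up or down to integers
    ((∀ a b : ℕ → ℕ,
        (∀ n, |(a n : ℝ) - n * (1 - ExpHist.upperMass ρ)| < 1) →
        (∀ n, |(b n : ℝ) - n * ExpHist.upperMass ρ| < 1) →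
        (fun n : ℕ => ExpHist.expectedOccupancy P ρ X n) ~[atTop]
          (fun n : ℕ => ExpHist.expectedOccupancy P₀ ρ X₀ (a n) +
            ExpHist.expectedOccupancy P₁ ρ X₁ (b n)) ∧
        ∃ C : ℝ, ∀ n : ℕ, |ExpHist.expectedOccupancy P ρ X n -
          (ExpHist.expectedOccupancy P₀ ρ X₀ (a n) +
            ExpHist.expectedOccupancy P₁ ρ X₁ (b n))| ≤ C) ∧
      (∀ ε : ℝ, 0 < ε → ∀ᶠ n : ℕ in atTop,
        ExpHist.expectedOccupancy P ρ X n ≤ (1 + ε) * Real.logb ρ n) ∧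
      ρ ^ ExpHist.kappa lam ρ = ExpHist.cutoff lam ρ ∧
      (∀ n : ℕ,
        ∫ ω, (((Finset.range n).filter
          (fun i => X i ω ≤ ExpHist.cutoff lam ρ)).card : ℝ) ∂P
            = n * (1 - ExpHist.upperMass ρ)) ∧
      (∀ n : ℕ,
        ∫ ω, (((Finset.range n).filter
          (fun i => ExpHist.cutoff lam ρ < X i ω)).card : ℝ) ∂P
            = n * ExpHist.upperMass ρ)) := by
  have hu0 := ExpHist.upperMass_pos hρ
  have hu1 := ExpHist.upperMass_lt_one hρ
  have hlog := ExpHist.tendsto_logb_nat hρ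
  have hloglog := ExpHist.tendsto_logb_log_nat hρ
  have h0 := hX₀.expectedOccupancy_sub_logb_isBigO hρ hlam
  have h1 := hX₁.expectedOccupancy_sub_logb_log_isBigO hρ hlam
  have h := hX.expectedOccupancy_exp_isBigO hρ hlam
  have hE := ExpHist.isEquivalent_of_sub_isBigO_one h (hlog.atTop_add_atTop hloglog)
  have hcut : ExpHist.upperMass ρ = 1 - cdf (expMeasure lam) (ExpHist.cutoff lam ρ) := by
    rw [ExpHist.cdf_exp_eq hlam (ExpHist.cutoff_pos hρ hlam).le, ExpHist.upperMass_eq hρ hlam]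
    ring
  refine ⟨⟨?_, ?_⟩, ⟨?_, ExpHist.arg1_eventually_mem hρ, fun n => ExpHist.approx1_le_bound1 hρ, ?_⟩,
    fun a b ha hb => ?_, fun ε hε => ?_, ExpHist.rpow_kappa hρ hlam, fun n => ?_, fun n => ?_⟩
  · exact (ExpHist.isEquivalent_of_sub_isBigO_one h0 hlog).trans
      (ExpHist.isEquivalent_of_sub_isBigO_one (ExpHist.approx0_sub_logb_isBigO hρ) hlog).symm
  · exact ExpHist.isEquivalent_of_sub_isBigO_one (ExpHist.approx0_sub_logb_isBigO hρ) hlog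
  · exact (ExpHist.isEquivalent_of_sub_isBigO_one h1 hloglog).trans
      (ExpHist.isEquivalent_of_sub_isBigO_one (ExpHist.approx1_sub_logb_log_isBigO hρ) hloglog).symm
  · exact (ExpHist.isEquivalent_of_sub_isBigO_one (ExpHist.bound1_sub_logb_log_isBigO hρ)
      hloglog).trans (ExpHist.isEquivalent_of_sub_isBigO_one
        (ExpHist.logb_logb_sub_logb_log_isBigO hρ) hloglog).symm
  · have ha' := ExpHist.rounded_tendsto (by linarith) (by linarith) ha
    have hb' := ExpHist.rounded_tendsto hu0 hu1 hb
    have hsum : (fun n : ℕ => ExpHist.expectedOccupancy P₀ ρ X₀ (a n) +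
        ExpHist.expectedOccupancy P₁ ρ X₁ (b n) - (Real.logb ρ n + Real.logb ρ (Real.log n)))
        =O[atTop] (fun _ => (1 : ℝ)) := by
      have h2 := (h0.comp_tendsto ha').add
        (ExpHist.logb_rounded_isBigO hρ (by linarith) (by linarith) ha)
      have h3 := (h1.comp_tendsto hb').add (ExpHist.logb_log_rounded_isBigO hρ hu0 hu1 hb)
      refine (h2.add h3).congr_left fun n => ?_
      simp only [Function.comp_apply]
      ring
    refine ⟨hE.trans (ExpHist.isEquivalent_of_sub_isBigO_one hsum
      (hlog.atTop_add_atTop hloglog)).symm, ?_⟩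
    -- Along `ℕ`, an eventual bound extends to all `n`, since only finitely many terms are left out.
    exact isBigO_one_nat_atTop_iff.1 ((h.sub hsum).congr_left fun n => by ring)
  -- The bounded error and the term `log_ρ log n` are both negligible against `log_ρ n`.
  · have hlittle : (fun n : ℕ => ExpHist.expectedOccupancy P ρ X n - Real.logb ρ n) =o[atTop]
        (fun n : ℕ => Real.logb ρ n) := by
      refine ((h.trans_isLittleO (isLittleO_const_left.2
        (Or.inr (tendsto_norm_atTop_atTop.comp hlog)))).add
          (ExpHist.logb_log_isLittleO_logb hρ)).congr_left fun n => by ring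
    filter_upwards [hlittle.def hε, hlog.eventually_ge_atTop 0] with n hn hn0
    rw [Real.norm_eq_abs, Real.norm_of_nonneg hn0] at hn
    linarith [le_abs_self (ExpHist.expectedOccupancy P ρ X n - Real.logb ρ n)]
  · rw [hX.integral_card_le, hcut, sub_sub_cancel]
  · rw [hX.integral_card_lt, hcut]
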